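/- Let $k$ be a field and $n\ge 1$. For a finite subset $A=\{a_1,\dots,a_p\}\subset\mathbb{N}^n$ let $\langle A\rangle$ be the semigroup generated by $A$, let $I_A\subset k[x_1,\dots,x_p]$ be the kernel of the $k$-algebra homomorphism $x_j\mapsto t^{a_j}\in k[t_1,\dots,t_n]$, and let $k[A]=k[x_1,\dots,x_p]/I_A$. Call $\langle A\rangle$ nondegenerate if the Krull dimension of $k[A]$ is $n$, and degenerate otherwise. Two semigroups $\langle A\rangle$, $\langle B\rangle$ with $A=\{a_1,\dots,a_p\}$, $B=\{b_1,\dots,b_q\}\subset\mathbb{N}^n$ can be glued if there are positive integers $k_1,k_2$ such that, for $C=k_1A\cup k_2B$ and $I_C$ the kernel of $k[x_1,\dots,x_p,y_1,\dots,y_q]\to k[t_1,\dots,t_n]$, $x_i\mapsto t^{k_1a_i}$, $y_j\mapsto t^{k_2b_j}$, one has $I_C=I_A+I_B+\langle x^\alpha-y^\beta\rangle$ for some $\alpha\in\mathbb{N}^p$, $\beta\in\mathbb{N}^q$ (where $I_A$ and $I_B$ stand for the ideals they generate in the larger ring). Let $A,B\subset\mathbb{N}^n$ be finite subsets such that $k[A]$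 and $k[B]$ are Cohen–Macaulay. If $\langle A\rangle$ and $\langle B\rangle$ are nondegenerate, then they can be glued if and only if $n=1$; moreover, if $n=1$ and $0\notin A\cap B$, then $k_1$ and $k_2$ can be chosen with $k_1A\cap k_2B=\emptyset$. Consequently, if $n\ge 2$ and $\langle A\rangle$ and $\langle B\rangle$ can be glued, then at least one of $\langle A\rangle$ and $\langle B\rangle$ is degenerate. -/

import Mathlib

namespace SemigroupGluing

noncomputable section

open MvPolynomial

/-- The (pure) monomial `∏ i, X i ^ α i` with exponent vector `α`. -/
def mono (k : Type*) [Field k] {ι : Type*} [Fintype ι] (α : ι → ℕ) : MvPolynomial ι k :=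
  ∏ i, X i ^ α i

/-- For a finite family `v` of vectors in `ℕⁿ`, the `k`-algebra homomorphism
`k[x_i | i ∈ ι] → k[t_1, …, t_n]`, `x_i ↦ t ^ (v i)`. -/
def toricMap (k : Type*) [Field k] {ι : Type*} {n : ℕ} (v : ι → Fin n → ℕ) :
    MvPolynomial ι k →ₐ[k] MvPolynomial (Fin n) k :=
  aeval fun i => mono k (v i)

/-- The defining ideal of the semigroup generated by the family `v`. -/
def toricIdeal (k : Type*) [Field k] {ι : Type*} {n : ℕ} (v : ι → Fin n → ℕ) :
    Ideal (MvPolynomial ι k) :=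
  RingHom.ker (toricMap k v)

/-- The ideal `I_A` of a finite set `A ⊆ ℕⁿ`; there is one variable for each element of `A`. -/
def defIdeal (k : Type*) [Field k] {n : ℕ} (A : Finset (Fin n → ℕ)) :
    Ideal (MvPolynomial A k) :=
  toricIdeal k fun a : A => (a : Fin n → ℕ)

/-- The semigroup ring `k[A] = k[x_a | a ∈ A] / I_A`. -/
abbrev SemigroupRing (k : Type*) [Field k] {n : ℕ} (A : Finset (Fin n → ℕ)) : Type _ :=
  MvPolynomial A k ⧸ defIdeal k A

/-- `⟨A⟩ ⊆ ℕⁿ` is nondegenerate if the Krull dimension of `k[A]` is `n`. -/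
def Nondegenerate (k : Type*) [Field k] {n : ℕ} (A : Finset (Fin n → ℕ)) : Prop :=
  ringKrullDim (SemigroupRing k A) = n

/-- The depth of a local ring: the supremum of the lengths of the regular sequences
contained in the maximal ideal. -/
def localDepth (R : Type*) [CommRing R] [IsLocalRing R] : ℕ∞ :=
  ⨆ (rs : List R) (_ : RingTheory.Sequence.IsRegular R rs ∧
    ∀ r ∈ rs, r ∈ IsLocalRing.maximalIdeal R), (rs.length : ℕ∞)

/-- A Noetherian ring is Cohen–Macaulay if each of its localizations at a prime ideal has depth
equal to its Krull dimension. -/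
def IsCohenMacaulay (R : Type*) [CommRing R] : Prop :=
  IsNoetherianRing R ∧ ∀ (P : Ideal R) [P.IsPrime],
    ((localDepth (Localization.AtPrime P) : ℕ∞) : WithBot ℕ∞) =
      ringKrullDim (Localization.AtPrime P)

/-- The ideal `I_C` of `C = k₁A ∪ k₂B` in the polynomial ring with one variable `x_a` for each
`a ∈ A` (mapped to `t ^ (k₁ a)`) and one variable `y_b` for each `b ∈ B` (mapped to
`t ^ (k₂ b)`). -/
def unionIdeal (k : Type*) [Field k] {n : ℕ} (A B : Finset (Fin n → ℕ)) (k₁ k₂ : ℕ) :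
    Ideal (MvPolynomial (A ⊕ B) k) :=
  toricIdeal k (Sum.elim (fun a : A => k₁ • (a : Fin n → ℕ)) fun b : B => k₂ • (b : Fin n → ℕ))

/-- For `C = k₁A ∪ k₂B` with `k₁, k₂` positive, `⟨C⟩` is a gluing of `⟨A⟩` and `⟨B⟩`:
`I_C = I_A + I_B + ⟨x^α - y^β⟩` for some exponent vectors `α`, `β`. -/
def IsGluing (k : Type*) [Field k] {n : ℕ} (A B : Finset (Fin n → ℕ)) (k₁ k₂ : ℕ) : Prop :=
  0 < k₁ ∧ 0 < k₂ ∧ ∃ (α : A → ℕ) (β : B → ℕ),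
    unionIdeal k A B k₁ k₂ =
      (defIdeal k A).map (rename Sum.inl : MvPolynomial A k →ₐ[k] MvPolynomial (A ⊕ B) k) ⊔
      (defIdeal k B).map (rename Sum.inr : MvPolynomial B k →ₐ[k] MvPolynomial (A ⊕ B) k) ⊔
      Ideal.span {rename Sum.inl (mono k α) - rename Sum.inr (mono k β)}

/-- `⟨A⟩` and `⟨B⟩` can be glued. -/
def CanBeGlued (k : Type*) [Field k] {n : ℕ} (A B : Finset (Fin n → ℕ)) : Prop :=
  ∃ k₁ k₂ : ℕ, IsGluing k A B k₁ k₂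

end

end SemigroupGluing

namespace SemigroupGluing

open MvPolynomial

/-! ### Monomials and the binomial description of toric ideals -/

section Monomials

variable (k : Type*) [Field k]

/-! Necessity: if `I_C = I_A + I_B + ⟨x^α - y^β⟩`, grade the variables by `ℤⁿ × ℤⁿ` modulo the
single vector `w = (∑ α a, -∑ β b)`. All generators of `I_C` vanish in the group algebra of this
quotient, so every relation `k₁ p + k₂ q = 0` with `p ∈ ℤA`, `q ∈ ℤB` has `(p, q) ∈ ℤw`
(`IsGluing.exists_relation`). Nondegeneracy yields `n` independent generators
(`Nondegenerate.exists_linearIndepOn`). Those of `B` span `ℚⁿ`, so each `a ∈ A` has a nonzero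
multiple in such a relation and lies on one line; those of `A` then force `n ≤ 1`.

Sufficiency: for `n = 1`, let `d`, `e` be the gcds of `A`, `B`. For large `T`, `dT ∈ ⟨A⟩` and
`e(T+1) ∈ ⟨B⟩`. With `k₁ = e(T+1)`, `k₂ = dT`, coprimality of `T` and `T+1` makes every relation a
multiple of the one between these two elements, and `isGluing_of_forall` applies. -/

theorem mono_eq_monomial {ι : Type*} [Fintype ι] (α : ι → ℕ) :
    mono k α = monomial (Finsupp.equivFunOnFinite.symm α) 1 := by
  classical
  rw [mono, monomial_eq, Finsupp.prod_fintype _ _ (by simp)]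
  simp

theorem mono_injective {ι : Type*} [Fintype ι] :
    Function.Injective (mono k : (ι → ℕ) → MvPolynomial ι k) := fun α β h ↦ by
  rw [mono_eq_monomial, mono_eq_monomial, monomial_left_inj one_ne_zero] at h
  exact Finsupp.equivFunOnFinite.symm.injective h

theorem mono_ne_zero {ι : Type*} [Fintype ι] (α : ι → ℕ) : mono k α ≠ 0 := by
  rw [mono_eq_monomial]
  simp

theorem mono_add {ι : Type*} [Fintype ι] (α β : ι → ℕ) :
    mono k (α + β) = mono k α * mono k β := by
  simp [mono, pow_add, Finset.prod_mul_distrib]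

theorem mono_nsmul {ι : Type*} [Fintype ι] (m : ℕ) (α : ι → ℕ) :
    mono k (m • α) = mono k α ^ m := by
  simp [mono, mul_comm m, pow_mul, Finset.prod_pow]

theorem mono_sum {ι κ : Type*} [Fintype ι] (s : Finset κ) (f : κ → ι → ℕ) :
    mono k (∑ i ∈ s, f i) = ∏ i ∈ s, mono k (f i) := by
  simp only [mono, Finset.sum_apply, ← Finset.prod_pow_eq_pow_sum]
  exact Finset.prod_comm

variable {ι : Type*} {n : ℕ}

theorem toricMap_mono [Fintype ι] (v : ι → Fin n → ℕ) (α : ι → ℕ) :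
    toricMap k v (mono k α) = mono k (∑ i, α i • v i) := by
  rw [mono_sum]
  simp [toricMap, mono, map_prod, mul_comm, pow_mul, Finset.prod_pow]

/-- The algebra map to a monoid algebra that sends variables to prescribed group elements sends
monomials to group elements. -/
theorem aeval_single_mono [Fintype ι] {M : Type*} [AddCommMonoid M] (x : ι → M) (α : ι → ℕ) :
    aeval (fun i ↦ (AddMonoidAlgebra.single (x i) 1 : AddMonoidAlgebra k M)) (mono k α) =
      AddMonoidAlgebra.single (∑ i, α i • x i) 1 := by
  classical
  simp only [mono, map_prod, map_pow, aeval_X, AddMonoidAlgebra.single_pow, one_pow]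
  induction (Finset.univ : Finset ι) using Finset.induction_on with
  | empty => simp [AddMonoidAlgebra.one_def]
  | insert a s ha ih => simp [Finset.prod_insert ha, Finset.sum_insert ha, ih,
      AddMonoidAlgebra.single_mul_single]

/-- A toric ideal is spanned by its binomials. -/
theorem toricIdeal_le [Fintype ι] (v : ι → Fin n → ℕ) (J : Ideal (MvPolynomial ι k))
    (hJ : ∀ α β : ι → ℕ, ∑ i, α i • v i = ∑ i, β i • v i → mono k α - mono k β ∈ J) :
    toricIdeal k v ≤ J := by
  classical
  let deg : (ι → ℕ) → Fin n → ℕ := fun α ↦ ∑ i, α i • v i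
  -- Sending `t^m` to the class of a chosen monomial of degree `m` factors the quotient map by `J`
  -- through `toricMap`. The value at unattained degrees is irrelevant.
  let rep : (Fin n →₀ ℕ) → ι → ℕ := fun m ↦ Function.invFun deg m
  let G : MvPolynomial (Fin n) k →ₗ[k] MvPolynomial ι k ⧸ J :=
    (basisMonomials (Fin n) k).constr k fun m ↦ Ideal.Quotient.mk J (mono k (rep m))
  have hG : G ∘ₗ (toricMap k v).toLinearMap = (Ideal.Quotient.mkₐ k J).toLinearMap := by
    refine (basisMonomials ι k).ext fun s ↦ ?_
    have hs : monomial s (1 : k) = mono k s := by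
      rw [mono_eq_monomial]; congr; ext; simp
    simp only [coe_basisMonomials, LinearMap.comp_apply, AlgHom.toLinearMap_apply, hs,
      toricMap_mono]
    rw [mono_eq_monomial]
    have h1 := (basisMonomials (Fin n) k).constr_basis k
      (fun m ↦ Ideal.Quotient.mk J (mono k (rep m)))
      (Finsupp.equivFunOnFinite.symm (∑ i, s i • v i))
    rw [coe_basisMonomials] at h1
    refine h1.trans ?_
    refine Ideal.Quotient.eq.2 (hJ _ _ ?_)
    exact Function.invFun_eq (f := deg) ⟨s, rfl⟩
  intro f hf
  have hf' : toricMap k v f = 0 := hf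
  have := LinearMap.congr_fun hG f
  simp only [LinearMap.comp_apply, AlgHom.toLinearMap_apply, hf', map_zero] at this
  exact Ideal.Quotient.eq_zero_iff_mem.1 this.symm

end Monomials

/-- A vector of natural numbers, viewed as a vector of integers. -/
def intVec {n : ℕ} (a : Fin n → ℕ) : Fin n → ℤ := fun j ↦ a j

theorem intVec_injective {n : ℕ} : Function.Injective (intVec (n := n)) := fun _ _ h ↦
  funext fun j ↦ Nat.cast_injective (R := ℤ) (congrFun h j)

theorem intVec_sum {n : ℕ} {ι : Type*} [Fintype ι] (v : ι → Fin n → ℕ) (α : ι → ℕ) :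
    intVec (∑ i, α i • v i) = ∑ i, (α i : ℤ) • intVec (v i) := by
  ext j
  simp [intVec, Finset.sum_apply]

/-- An integer relation between the vectors `v i` splits into an equality with natural
coefficients. -/
theorem sum_toNat_eq {n : ℕ} {ι : Type*} [Fintype ι] (v : ι → Fin n → ℕ) (c : ι → ℤ)
    (h : ∑ i, c i • intVec (v i) = 0) :
    ∑ i, (c i).toNat • v i = ∑ i, (-c i).toNat • v i := by
  apply intVec_injective
  rw [intVec_sum, intVec_sum, ← sub_eq_zero, ← Finset.sum_sub_distrib, ← h]
  refine Finset.sum_congr rfl fun i _ ↦ ?_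
  rw [← sub_smul]
  congr 1
  omega

/-! ### Krull dimension and independent generators -/

section Dimension

/-- Incomparability: contraction of primes along an integral map preserves strict inclusions. -/
theorem ringKrullDim_le_of_isIntegral {R S : Type*} [CommRing R] [CommRing S] [Algebra R S]
    [Algebra.IsIntegral R S] : ringKrullDim S ≤ ringKrullDim R :=
  Order.krullDim_le_of_strictMono (PrimeSpectrum.comap (algebraMap R S)) fun I J h ↦
    Ideal.IsIntegral.comap_lt_comap (I := I.asIdeal) (J := J.asIdeal) h

/-- The Krull dimension of a finitely generated algebra is at most any bound for its
transcendence degree. -/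
theorem ringKrullDim_le_of_trdeg_le (k R : Type*) [Field k] [CommRing R] [Nontrivial R]
    [Algebra k R] [Algebra.FiniteType k R] (r : ℕ) (h : Algebra.trdeg k R ≤ r) :
    ringKrullDim R ≤ r := by
  -- Noether normalization: the `s` variables bound the dimension, and their images are
  -- algebraically independent.
  obtain ⟨s, g, hg, hint⟩ := exists_integral_inj_algHom_of_fg k R
  let := g.toRingHom.toAlgebra
  have : Algebra.IsIntegral (MvPolynomial (Fin s) k) R := ⟨hint⟩
  have hdim : ringKrullDim R ≤ s := by
    refine (ringKrullDim_le_of_isIntegral (R := MvPolynomial (Fin s) k)).trans ?_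
    rw [MvPolynomial.ringKrullDim_of_isNoetherianRing]
    simp
  have hind : AlgebraicIndependent k fun i ↦ g (X i) := by
    rw [AlgebraicIndependent]
    convert! hg
    ext i
    simp
  have h1 := hind.lift_cardinalMk_le_trdeg.trans (Cardinal.lift_le.2 h)
  simp only [Cardinal.mk_fin, Cardinal.lift_natCast, Nat.cast_le] at h1
  exact hdim.trans (by exact_mod_cast h1)

variable (k : Type*) [Field k] {n : ℕ} (A : Finset (Fin n → ℕ))

instance : (defIdeal k A).IsPrime := RingHom.ker_isPrime _

/-- The class of a monomial whose exponents are supported in `s` lies in the subalgebra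
generated by the variables in `s`. -/
theorem mk_mono_mem_adjoin (s : Set A) (α : A → ℕ) (hα : ∀ a ∉ s, α a = 0) :
    Ideal.Quotient.mk (defIdeal k A) (mono k α) ∈
      Algebra.adjoin k ((fun a ↦ Ideal.Quotient.mk (defIdeal k A) (X a)) '' s) := by
  rw [mono, map_prod]
  refine Subalgebra.prod_mem _ fun a _ ↦ ?_
  by_cases ha : a ∈ s
  · rw [map_pow]
    exact Subalgebra.pow_mem _ (Algebra.subset_adjoin (Set.mem_image_of_mem _ ha)) _
  · simp [hα a ha]

theorem mk_mono_eq_mk_mono_iff (α β : A → ℕ) :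
    Ideal.Quotient.mk (defIdeal k A) (mono k α) = Ideal.Quotient.mk (defIdeal k A) (mono k β) ↔
      ∑ a, α a • (a : Fin n → ℕ) = ∑ a, β a • (a : Fin n → ℕ) := by
  rw [Ideal.Quotient.eq, defIdeal, toricIdeal, RingHom.sub_mem_ker_iff,
    ← (mono_injective k).eq_iff, ← toricMap_mono k (fun a : A ↦ (a : Fin n → ℕ)),
    ← toricMap_mono k (fun a : A ↦ (a : Fin n → ℕ))]

theorem mk_mono_ne_zero (α : A → ℕ) : Ideal.Quotient.mk (defIdeal k A) (mono k α) ≠ 0 := by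
  rw [Ne, Ideal.Quotient.eq_zero_iff_mem]
  intro h
  have h' : toricMap k (fun a : A ↦ (a : Fin n → ℕ)) (mono k α) = 0 := h
  rw [toricMap_mono] at h'
  exact mono_ne_zero k _ h'

/-- A variable is algebraic over the variables in `s` if a nonzero multiple of its exponent
vector is in the span of those of `s`. -/
theorem isAlgebraic_mk_X (s : Set A) (a : A) (N : ℤ) (hN : N ≠ 0)
    (h : N • intVec (a : Fin n → ℕ) ∈
      Submodule.span ℤ ((fun a : A ↦ intVec (a : Fin n → ℕ)) '' s)) :
    IsAlgebraic (Algebra.adjoin k ((fun a ↦ Ideal.Quotient.mk (defIdeal k A) (X a)) '' s))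
      (Ideal.Quotient.mk (defIdeal k A) (X a)) := by
  classical
  obtain ⟨l, hl, hla⟩ := (Finsupp.mem_span_image_iff_linearCombination ℤ).1 h
  rw [Finsupp.linearCombination_apply, Finsupp.sum_fintype _ _ (by simp)] at hla
  have hl0 : ∀ b ∉ s, l b = 0 := fun b hb ↦ by
    by_contra h0
    exact hb (hl (by simpa using h0))
  let P : Algebra.adjoin k ((fun a ↦ Ideal.Quotient.mk (defIdeal k A) (X a)) '' s) :=
    ⟨_, mk_mono_mem_adjoin k A s (fun b ↦ (-l b).toNat) fun b hb ↦ by simp [hl0 b hb]⟩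
  let Q : Algebra.adjoin k ((fun a ↦ Ideal.Quotient.mk (defIdeal k A) (X a)) '' s) :=
    ⟨_, mk_mono_mem_adjoin k A s (fun b ↦ (l b).toNat) fun b hb ↦ by simp [hl0 b hb]⟩
  have hP : P ≠ 0 := fun h0 ↦ mk_mono_ne_zero k A _ (congrArg Subtype.val h0)
  -- A relation `N a = ∑ l b`, with negative terms moved across, becomes `P Z^(N⁺) = Q Z^(N⁻)`. This
  -- covers both signs of `N`; the exponents differ because `N ≠ 0`.
  refine ⟨Polynomial.monomial N.toNat P - Polynomial.monomial (-N).toNat Q, fun h0 ↦ hP ?_, ?_⟩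
  · have h1 := congrArg (fun p ↦ p.coeff N.toNat) h0
    have h2 : (-N).toNat ≠ N.toNat := by omega
    simpa [Polynomial.coeff_monomial, h2] using h1
  · simp only [map_sub, Polynomial.aeval_monomial, sub_eq_zero]
    have hX : ∀ m : ℕ, (X a ^ m : MvPolynomial A k) = mono k (Pi.single a m) := fun m ↦ by
      rw [mono, Finset.prod_eq_single a] <;> simp +contextual
    change Ideal.Quotient.mk (defIdeal k A) _ * _ = Ideal.Quotient.mk (defIdeal k A) _ * _
    rw [← map_pow, ← map_pow, ← map_mul, ← map_mul, hX, hX, ← mono_add, ← mono_add,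
      mk_mono_eq_mk_mono_iff]
    apply intVec_injective
    rw [intVec_sum, intVec_sum, ← sub_eq_zero, ← Finset.sum_sub_distrib]
    have : ∀ b : A, ((((fun b ↦ (-l b).toNat) + Pi.single a N.toNat : A → ℕ) b : ℕ) : ℤ) •
          intVec (b : Fin n → ℕ) -
        ((((fun b ↦ (l b).toNat) + Pi.single a (-N).toNat : A → ℕ) b : ℕ) : ℤ) •
          intVec (b : Fin n → ℕ) =
        (Pi.single a N : A → ℤ) b • intVec (b : Fin n → ℕ) - l b • intVec (b : Fin n → ℕ) := by
      intro b
      rw [← sub_smul, ← sub_smul]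
      congr 1
      by_cases hb : b = a
      · subst hb
        simp only [Pi.add_apply, Pi.single_eq_same]
        omega
      · simp only [Pi.add_apply, Pi.single_eq_of_ne hb]
        omega
    rw [Finset.sum_congr rfl fun b _ ↦ this b, Finset.sum_sub_distrib, hla,
      Finset.sum_eq_single a]
    · simp
    · intro b _ hb
      simp [Pi.single_eq_of_ne hb]
    · simp

/-- A nondegenerate semigroup has `n` linearly independent generators. -/
theorem Nondegenerate.exists_linearIndepOn (h : Nondegenerate k A) :
    ∃ s : Set A, LinearIndepOn ℤ (fun a : A ↦ intVec (a : Fin n → ℕ)) s ∧ n ≤ s.ncard := by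
  -- By maximality every other generator has a nonzero multiple in the span of `s`, so `k[A]` is
  -- algebraic over the variables in `s`.
  obtain ⟨s, hs, hmax⟩ := exists_maximal_linearIndepOn ℤ fun a : A ↦ intVec (a : Fin n → ℕ)
  refine ⟨s, hs, ?_⟩
  set S := (fun a ↦ Ideal.Quotient.mk (defIdeal k A) (X a)) '' s
  have halg : ∀ p : MvPolynomial A k,
      IsAlgebraic (Algebra.adjoin k S) (Ideal.Quotient.mk (defIdeal k A) p) := fun p ↦ by
    induction p using MvPolynomial.induction_on with
    | C c =>
      exact isAlgebraic_algebraMap (A := SemigroupRing k A) (algebraMap k (Algebra.adjoin k S) c)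
    | add p q hp hq =>
      rw [map_add]
      exact hp.add hq
    | mul_X p a hp =>
      rw [map_mul]
      refine hp.mul ?_
      by_cases ha : a ∈ s
      · exact isAlgebraic_algebraMap
          (⟨_, Algebra.subset_adjoin ⟨a, ha, rfl⟩⟩ : Algebra.adjoin k S)
      · obtain ⟨N, hN, hNa⟩ := hmax a ha
        exact isAlgebraic_mk_X k A s a N hN hNa
  have : Algebra.IsAlgebraic (Algebra.adjoin k S) (SemigroupRing k A) := ⟨fun x ↦ by
    obtain ⟨p, rfl⟩ := Ideal.Quotient.mk_surjective x
    exact halg p⟩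
  have htr : Algebra.trdeg k (SemigroupRing k A) ≤ (s.ncard : ℕ) := by
    refine (Algebra.IsAlgebraic.trdeg_le_cardinalMk k S).trans ?_
    have hSf : S.Finite := (Set.toFinite s).image _
    rw [← Set.cast_ncard hSf, Nat.cast_le]
    exact Set.ncard_image_le (Set.toFinite s)
  have := ringKrullDim_le_of_trdeg_le k (SemigroupRing k A) _ htr
  rw [show ringKrullDim (SemigroupRing k A) = n from h] at this
  exact_mod_cast this

end Dimension

/-! ### Gluings and relations between the two semigroups -/

section Gluing

variable {k : Type*} [Field k] {n : ℕ} {A B : Finset (Fin n → ℕ)} {k₁ k₂ : ℕ}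

/-- In a gluing all relations between `k₁A` and `k₂B` come from a single one. -/
theorem IsGluing.exists_relation (h : IsGluing k A B k₁ k₂) :
    ∃ w : (Fin n → ℤ) × (Fin n → ℤ), ∀ (c : A → ℤ) (d : B → ℤ),
      k₁ • ∑ a, c a • intVec (a : Fin n → ℕ) + k₂ • ∑ b, d b • intVec (b : Fin n → ℕ) = 0 →
      ∃ m : ℤ, m • w =
        (∑ a, c a • intVec (a : Fin n → ℕ), ∑ b, d b • intVec (b : Fin n → ℕ)) := by
  classical
  obtain ⟨-, -, α, β, hI⟩ := h
  let u : Fin n → (Fin n → ℤ) × (Fin n → ℤ) := fun i ↦ (Pi.single i 1, 0)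
  let u' : Fin n → (Fin n → ℤ) × (Fin n → ℤ) := fun i ↦ (0, Pi.single i 1)
  have hu : ∀ a : Fin n → ℕ, ∑ i, a i • u i = (intVec a, 0) := fun a ↦ by
    ext j <;> simp [u, intVec, Prod.fst_sum, Prod.snd_sum, Finset.sum_apply, Pi.single_apply]
  have hu' : ∀ a : Fin n → ℕ, ∑ i, a i • u' i = (0, intVec a) := fun a ↦ by
    ext j <;> simp [u', intVec, Prod.fst_sum, Prod.snd_sum, Finset.sum_apply, Pi.single_apply]
  let w : (Fin n → ℤ) × (Fin n → ℤ) :=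
    (intVec (∑ a, α a • (a : Fin n → ℕ)), -intVec (∑ b, β b • (b : Fin n → ℕ)))
  let π := QuotientAddGroup.mk' (AddSubgroup.zmultiples w)
  let x : A ⊕ B → (Fin n → ℤ) × (Fin n → ℤ) :=
    Sum.elim (fun a ↦ (intVec a, 0)) fun b ↦ (0, intVec b)
  let ψ := aeval (R := k) fun i ↦ (AddMonoidAlgebra.single (π (x i)) 1 : AddMonoidAlgebra k _)
  -- On each block of variables `ψ` factors through the toric map, hence kills `I_A` and `I_B`.
  have hl : ψ.comp (rename Sum.inl) =
      (aeval fun i ↦ AddMonoidAlgebra.single (π (u i)) 1).comp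
        (toricMap k fun a : A ↦ (a : Fin n → ℕ)) := by
    ext1 a
    simp only [AlgHom.comp_apply, rename_X, toricMap, aeval_X, aeval_single_mono, ψ, x,
      Sum.elim_inl, ← map_nsmul, ← map_sum, hu]
  have hr : ψ.comp (rename Sum.inr) =
      (aeval fun i ↦ AddMonoidAlgebra.single (π (u' i)) 1).comp
        (toricMap k fun b : B ↦ (b : Fin n → ℕ)) := by
    ext1 b
    simp only [AlgHom.comp_apply, rename_X, toricMap, aeval_X, aeval_single_mono, ψ, x,
      Sum.elim_inr, ← map_nsmul, ← map_sum, hu']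
  have hle : unionIdeal k A B k₁ k₂ ≤ RingHom.ker ψ := by
    rw [hI]
    refine sup_le (sup_le ?_ ?_) ?_
    · rw [Ideal.map_le_iff_le_comap]
      intro f hf
      have hf' : toricMap k (fun a : A ↦ (a : Fin n → ℕ)) f = 0 := hf
      have := AlgHom.congr_fun hl f
      rw [AlgHom.comp_apply, AlgHom.comp_apply, hf', map_zero] at this
      exact this
    · rw [Ideal.map_le_iff_le_comap]
      intro f hf
      have hf' : toricMap k (fun b : B ↦ (b : Fin n → ℕ)) f = 0 := hf
      have := AlgHom.congr_fun hr f
      rw [AlgHom.comp_apply, AlgHom.comp_apply, hf', map_zero] at this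
      exact this
    · rw [Ideal.span_singleton_le_iff_mem, RingHom.sub_mem_ker_iff]
      have h1 := AlgHom.congr_fun hl (mono k α)
      have h2 := AlgHom.congr_fun hr (mono k β)
      simp only [AlgHom.comp_apply, toricMap_mono, aeval_single_mono, ← map_nsmul, ← map_sum, hu,
        hu'] at h1 h2
      refine h1.trans (Eq.trans ?_ h2.symm)
      congr 1
      refine (QuotientAddGroup.eq).2 ?_
      -- The degree of `y^β` minus that of `x^α` is `-w`.
      refine ⟨-1, ?_⟩
      simp [w]
  refine ⟨w, fun c d hcd ↦ ?_⟩
  have hrel := sum_toNat_eq (Sum.elim (fun a : A => k₁ • (a : Fin n → ℕ)) fun b : B =>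
    k₂ • (b : Fin n → ℕ)) (Sum.elim c d) (by
      rw [← hcd, Fintype.sum_sum_type, Finset.smul_sum, Finset.smul_sum]
      congr 1 <;> refine Finset.sum_congr rfl fun i _ ↦ ?_ <;> ext j <;> simp [intVec] <;> ring)
  have hmem : mono k (fun i ↦ (Sum.elim c d i).toNat) - mono k (fun i ↦ (-Sum.elim c d i).toNat) ∈
      unionIdeal k A B k₁ k₂ := by
    rw [unionIdeal, toricIdeal, RingHom.sub_mem_ker_iff]
    change toricMap k _ _ = toricMap k _ _
    rw [toricMap_mono, toricMap_mono, hrel]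
  have hψ := hle hmem
  rw [RingHom.sub_mem_ker_iff] at hψ
  change ψ _ = ψ _ at hψ
  simp only [ψ, aeval_single_mono] at hψ
  -- Distinct group elements are distinct basis vectors, so equal images mean equal degrees modulo
  -- `w`.
  have hπ := AddMonoidAlgebra.single_left_injective (one_ne_zero (α := k)) hψ
  simp only [← map_nsmul, ← map_sum] at hπ
  obtain ⟨m, hm⟩ := QuotientAddGroup.eq.1 hπ
  refine ⟨-m, ?_⟩
  simp only at hm
  rw [neg_smul, hm, neg_add, neg_neg, ← sub_eq_add_neg, ← Finset.sum_sub_distrib]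
  have : ∀ i, (Sum.elim c d i).toNat • x i - (-Sum.elim c d i).toNat • x i =
      Sum.elim c d i • x i := fun i ↦ by
    rw [← natCast_zsmul, ← natCast_zsmul, ← sub_smul]
    congr 1
    omega
  rw [Finset.sum_congr rfl fun i _ ↦ this i, Fintype.sum_sum_type]
  ext j <;> simp [x, Prod.fst_sum, Prod.snd_sum, Finset.sum_apply]

/-- If `n` vectors `v i` with `i ∈ t` are independent in `ℤⁿ`, every vector has a nonzero
multiple in their span. -/
theorem exists_smul_eq_sum {ι : Type*} [Fintype ι] (v : ι → Fin n → ℤ) (t : Set ι)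
    (ht : LinearIndepOn ℤ v t) (hn : n ≤ t.ncard) (y : Fin n → ℤ) :
    ∃ N : ℤ, N ≠ 0 ∧ ∃ d : ι → ℤ, N • y = ∑ i, d i • v i := by
  classical
  -- At least `n + 1` vectors in `ℤⁿ` are dependent; independence of the `v i` then makes the
  -- coefficient of `y` nonzero.
  have hdep : ¬ LinearIndependent ℤ fun o : Option t ↦ o.elim y fun i ↦ v i := fun hli ↦ by
    have := hli.fintype_card_le_finrank
    rw [Fintype.card_option, Module.finrank_fin_fun, ← Nat.card_eq_fintype_card] at this
    have h2 : t.ncard = Nat.card t := rfl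
    omega
  obtain ⟨g, hg, o, ho⟩ := Fintype.not_linearIndependent_iff.1 hdep
  rw [Fintype.sum_option] at hg
  simp only [Option.elim] at hg
  have h0 : g none ≠ 0 := fun h0 ↦ by
    rw [h0, zero_smul, zero_add] at hg
    have hz := Fintype.linearIndependent_iff.1 ht (fun i ↦ g (some i)) hg
    cases o with
    | none => exact ho h0
    | some i => exact ho (hz i)
  refine ⟨g none, h0, fun i ↦ if hi : i ∈ t then -g (some ⟨i, hi⟩) else 0, ?_⟩
  rw [eq_neg_of_add_eq_zero_left hg, ← Finset.sum_neg_distrib]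
  rw [← Finset.sum_subset (Finset.subset_univ t.toFinset)
    fun i _ hi ↦ by beta_reduce; rw [dif_neg (by simpa using hi), zero_smul]]
  rw [Finset.sum_subtype t.toFinset (p := (· ∈ t)) (by simp)]
  refine Finset.sum_congr rfl fun i _ ↦ ?_
  simp

/-- Since `B` has full rank, `key` puts all of `A` on the line through `w.1`, which cannot contain
two independent vectors. -/
theorem IsGluing.le_one (h : IsGluing k A B k₁ k₂) (hA : Nondegenerate k A)
    (hB : Nondegenerate k B) : n ≤ 1 := by
  classical
  by_contra! hn
  obtain ⟨s, hs, hsn⟩ := hA.exists_linearIndepOn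
  obtain ⟨t, ht, htn⟩ := hB.exists_linearIndepOn
  obtain ⟨a, has, a', has', hne⟩ := (Set.one_lt_ncard (Set.toFinite s)).1 (hn.trans_le hsn)
  obtain ⟨w, hw⟩ := h.exists_relation
  have key : ∀ a : A, ∃ N : ℤ, N ≠ 0 ∧ ∃ m : ℤ, m • w.1 = N • intVec (a : Fin n → ℕ) := by
    intro a
    obtain ⟨N, hN, d, hd⟩ := exists_smul_eq_sum (fun b : B ↦ intVec (b : Fin n → ℕ)) t ht htn
      (intVec (a : Fin n → ℕ))
    have hsum : ∑ b : A, (Pi.single a (k₂ * N) : A → ℤ) b • intVec (b : Fin n → ℕ) =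
        (k₂ * N) • intVec (a : Fin n → ℕ) := by
      rw [Finset.sum_eq_single a] <;> simp +contextual
    -- The coefficients `k₂ N` and `-k₁ d` make the weighted sum vanish.
    obtain ⟨m, hm⟩ := hw (Pi.single a (k₂ * N)) (fun b ↦ -k₁ * d b) (by
      simp only [hsum, mul_smul, ← Finset.smul_sum, ← hd]
      ext j
      simp
      ring)
    refine ⟨k₂ * N, mul_ne_zero (by exact_mod_cast h.2.1.ne') hN, m, ?_⟩
    rw [← hsum, ← Prod.smul_fst, hm]
  obtain ⟨N, hN, m, hm⟩ := key a
  obtain ⟨N', hN', m', hm'⟩ := key a'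
  have hpair := (hs.mono (t := {a, a'}) (by
    rintro _ (rfl | rfl) <;> assumption))
  rw [LinearIndepOn.pair_iff _ hne] at hpair
  -- Both `m' N a` and `m N' a'` equal `m m' w.1`, so independence gives `m = 0`, and then `N a =
  -- 0`.
  have hz := hpair (m' * N) (-(m * N')) (by
    rw [neg_smul, mul_smul, mul_smul, ← hm, ← hm', smul_comm, add_neg_cancel])
  have hm0 : m = 0 := by
    simpa [hN'] using hz.2
  have := hpair N 0 (by rw [← hm, hm0]; simp)
  exact hN this.1

/-! ### Constructing a gluing from numerical relations -/

theorem mono_sumElim (u : A → ℕ) (v : B → ℕ) :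
    mono k (Sum.elim u v) = (rename Sum.inl (mono k u) * rename Sum.inr (mono k v) :
      MvPolynomial (A ⊕ B) k) := by
  simp [mono, Fintype.prod_sum_type]

theorem mono_sub_mono_mem_defIdeal {u u' : A → ℕ}
    (h : ∑ a, u a • (a : Fin n → ℕ) = ∑ a, u' a • (a : Fin n → ℕ)) :
    mono k u - mono k u' ∈ defIdeal k A :=
  Ideal.Quotient.eq.1 ((mk_mono_eq_mk_mono_iff k A u u').2 h)

theorem toricMap_union_mono (u : A → ℕ) (v : B → ℕ) :
    toricMap k (Sum.elim (fun a : A => k₁ • (a : Fin n → ℕ)) fun b : B => k₂ • (b : Fin n → ℕ))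
      (rename Sum.inl (mono k u) * rename Sum.inr (mono k v)) =
      mono k (k₁ • ∑ a, u a • (a : Fin n → ℕ) + k₂ • ∑ b, v b • (b : Fin n → ℕ)) := by
  rw [← mono_sumElim, toricMap_mono, Fintype.sum_sum_type, Finset.smul_sum, Finset.smul_sum]
  simp only [Sum.elim_inl, Sum.elim_inr, smul_comm k₁, smul_comm k₂]

theorem mono_zero {ι : Type*} [Fintype ι] : mono k (0 : ι → ℕ) = 1 := by
  simp [mono]

/-- A combinatorial criterion for a gluing. -/
theorem isGluing_of_forall (h₁ : 0 < k₁) (h₂ : 0 < k₂) (α : A → ℕ) (β : B → ℕ)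
    (hαβ : k₁ • ∑ a, α a • (a : Fin n → ℕ) = k₂ • ∑ b, β b • (b : Fin n → ℕ))
    (h : ∀ (u u' : A → ℕ) (v v' : B → ℕ),
      k₁ • ∑ a, u a • (a : Fin n → ℕ) + k₂ • ∑ b, v b • (b : Fin n → ℕ) =
        k₁ • ∑ a, u' a • (a : Fin n → ℕ) + k₂ • ∑ b, v' b • (b : Fin n → ℕ) →
      ∃ m : ℕ,
        (∑ a, u a • (a : Fin n → ℕ) = ∑ a, (u' + m • α) a • (a : Fin n → ℕ) ∧
          ∑ b, (v + m • β) b • (b : Fin n → ℕ) = ∑ b, v' b • (b : Fin n → ℕ)) ∨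
        (∑ a, u' a • (a : Fin n → ℕ) = ∑ a, (u + m • α) a • (a : Fin n → ℕ) ∧
          ∑ b, (v' + m • β) b • (b : Fin n → ℕ) = ∑ b, v b • (b : Fin n → ℕ))) :
    IsGluing k A B k₁ k₂ := by
  refine ⟨h₁, h₂, α, β, le_antisymm ?_ (sup_le (sup_le ?_ ?_) ?_)⟩
  · set J := (defIdeal k A).map (rename Sum.inl : MvPolynomial A k →ₐ[k] MvPolynomial (A ⊕ B) k) ⊔
      (defIdeal k B).map (rename Sum.inr : MvPolynomial B k →ₐ[k] MvPolynomial (A ⊕ B) k) ⊔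
      Ideal.span {rename Sum.inl (mono k α) - rename Sum.inr (mono k β)} with hJ
    have hl : ∀ u u' : A → ℕ, ∑ a, u a • (a : Fin n → ℕ) = ∑ a, u' a • (a : Fin n → ℕ) →
        Ideal.Quotient.mk J (rename Sum.inl (mono k u)) =
          Ideal.Quotient.mk J (rename Sum.inl (mono k u')) := fun u u' huu ↦ by
      rw [Ideal.Quotient.eq, ← map_sub]
      exact (le_sup_left.trans le_sup_left : _ ≤ J)
        (Ideal.mem_map_of_mem _ (mono_sub_mono_mem_defIdeal huu))
    have hr : ∀ v v' : B → ℕ, ∑ b, v b • (b : Fin n → ℕ) = ∑ b, v' b • (b : Fin n → ℕ) →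
        Ideal.Quotient.mk J (rename Sum.inr (mono k v)) =
          Ideal.Quotient.mk J (rename Sum.inr (mono k v')) := fun v v' hvv ↦ by
      rw [Ideal.Quotient.eq, ← map_sub]
      exact (le_sup_right.trans le_sup_left : _ ≤ J)
        (Ideal.mem_map_of_mem _ (mono_sub_mono_mem_defIdeal hvv))
    have hlr : Ideal.Quotient.mk J (rename Sum.inl (mono k α)) =
        Ideal.Quotient.mk J (rename Sum.inr (mono k β)) :=
      Ideal.Quotient.eq.2 ((le_sup_right : _ ≤ J) (Ideal.mem_span_singleton_self _))
    -- Modulo `J`, a factor `(x^α)^m` can be traded for `(y^β)^m`.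
    have step : ∀ (u u' : A → ℕ) (v v' : B → ℕ) (m : ℕ),
        ∑ a, u a • (a : Fin n → ℕ) = ∑ a, (u' + m • α) a • (a : Fin n → ℕ) →
        ∑ b, (v + m • β) b • (b : Fin n → ℕ) = ∑ b, v' b • (b : Fin n → ℕ) →
        Ideal.Quotient.mk J (rename Sum.inl (mono k u) * rename Sum.inr (mono k v)) =
          Ideal.Quotient.mk J (rename Sum.inl (mono k u') * rename Sum.inr (mono k v')) := by
      intro u u' v v' m hu hv
      rw [map_mul, map_mul, hl _ _ hu, ← hr _ _ hv, mono_add, mono_add, mono_nsmul, mono_nsmul]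
      simp only [map_mul, map_pow, hlr]
      ring
    refine toricIdeal_le k _ J fun γ δ hγδ ↦ ?_
    rw [← Sum.elim_comp_inl_inr γ, ← Sum.elim_comp_inl_inr δ, mono_sumElim, mono_sumElim,
      ← Ideal.Quotient.eq]
    obtain ⟨m, ⟨hu, hv⟩ | ⟨hu, hv⟩⟩ := h (γ ∘ Sum.inl) (δ ∘ Sum.inl) (γ ∘ Sum.inr)
      (δ ∘ Sum.inr) (by
        apply mono_injective k
        rw [← toricMap_union_mono, ← toricMap_union_mono, ← mono_sumElim, ← mono_sumElim,
          Sum.elim_comp_inl_inr, Sum.elim_comp_inl_inr, toricMap_mono, toricMap_mono, hγδ])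
    · exact step _ _ _ _ m hu hv
    · exact (step _ _ _ _ m hu hv).symm
  · rw [Ideal.map_le_iff_le_comap]
    refine toricIdeal_le k _ _ fun u u' huu ↦ ?_
    rw [Ideal.mem_comap, map_sub, unionIdeal, toricIdeal, RingHom.sub_mem_ker_iff]
    have h1 := toricMap_union_mono (k := k) (k₁ := k₁) (k₂ := k₂) u (0 : B → ℕ)
    have h2 := toricMap_union_mono (k := k) (k₁ := k₁) (k₂ := k₂) u' (0 : B → ℕ)
    rw [mono_zero, map_one, mul_one] at h1 h2
    exact h1.trans (by rw [huu]; exact h2.symm)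
  · rw [Ideal.map_le_iff_le_comap]
    refine toricIdeal_le k _ _ fun v v' hvv ↦ ?_
    rw [Ideal.mem_comap, map_sub, unionIdeal, toricIdeal, RingHom.sub_mem_ker_iff]
    have h1 := toricMap_union_mono (k := k) (k₁ := k₁) (k₂ := k₂) (0 : A → ℕ) v
    have h2 := toricMap_union_mono (k := k) (k₁ := k₁) (k₂ := k₂) (0 : A → ℕ) v'
    rw [mono_zero, map_one, one_mul] at h1 h2
    exact h1.trans (by rw [hvv]; exact h2.symm)
  · rw [Ideal.span_singleton_le_iff_mem, unionIdeal, toricIdeal, RingHom.sub_mem_ker_iff]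
    have h1 := toricMap_union_mono (k := k) (k₁ := k₁) (k₂ := k₂) α (0 : B → ℕ)
    have h2 := toricMap_union_mono (k := k) (k₁ := k₁) (k₂ := k₂) (0 : A → ℕ) β
    rw [mono_zero, map_one] at h1 h2
    rw [mul_one] at h1
    rw [one_mul] at h2
    refine h1.trans (Eq.trans ?_ h2.symm)
    congr 1
    rw [hαβ]
    simp only [Pi.zero_apply, zero_smul, Finset.sum_const_zero, smul_zero, add_zero, zero_add]

end Gluing

/-! ### The case `n = 1` -/

section NumericalSemigroups

/-- A numerical semigroup contains all large multiples of the gcd of its generators. -/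
theorem exists_gcd (A : Finset (Fin 1 → ℕ)) (hA : ∃ a ∈ A, a ≠ 0) :
    ∃ d : ℕ, 0 < d ∧ (∀ a ∈ A, d ∣ a 0) ∧
      ∃ N, ∀ m ≥ N, ∃ α : A → ℕ, ∑ a, α a • (a : Fin 1 → ℕ) = fun _ ↦ d * m := by
  classical
  obtain ⟨a, ha, ha0⟩ := hA
  let s : Set ℕ := (fun a : Fin 1 → ℕ ↦ a 0) '' A
  have hd : ∀ a ∈ A, Nat.setGcd s ∣ a 0 := fun a ha ↦ Nat.setGcd_dvd_of_mem ⟨a, ha, rfl⟩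
  have hpos : 0 < Nat.setGcd s := by
    rw [Nat.pos_iff_ne_zero]
    intro h0
    have := hd a ha
    rw [h0, zero_dvd_iff] at this
    exact ha0 (funext fun j ↦ by rw [Subsingleton.elim j 0, this]; rfl)
  refine ⟨Nat.setGcd s, hpos, hd, ?_⟩
  obtain ⟨N, hN⟩ := Nat.exists_mem_closure_of_ge s
  refine ⟨N, fun m hm ↦ ?_⟩
  have hmem := hN (Nat.setGcd s * m) (hm.trans (Nat.le_mul_of_pos_left m hpos)) ⟨m, rfl⟩
  have hex : ∀ x ∈ AddSubmonoid.closure s, ∃ α : A → ℕ, ∑ a, α a * (a : Fin 1 → ℕ) 0 = x := by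
    intro x hx
    induction hx using AddSubmonoid.closure_induction with
    | mem x hx =>
      obtain ⟨a, ha, rfl⟩ := hx
      exact ⟨Pi.single ⟨a, ha⟩ 1, by
        rw [Finset.sum_eq_single ⟨a, ha⟩] <;> simp +contextual⟩
    | zero => exact ⟨0, by simp⟩
    | add x y _ _ hx hy =>
      obtain ⟨α, rfl⟩ := hx
      obtain ⟨β, rfl⟩ := hy
      exact ⟨α + β, by simp [add_mul, Finset.sum_add_distrib]⟩
  obtain ⟨α, hα⟩ := hex _ hmem
  refine ⟨α, funext fun j ↦ ?_⟩
  rw [Subsingleton.elim j 0, ← hα]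
  simp [Finset.sum_apply]

theorem exists_eq_mul_of_dvd {A : Finset (Fin 1 → ℕ)} {d : ℕ} (hd : ∀ a ∈ A, d ∣ a 0)
    (u : A → ℕ) : ∃ s : ℕ, ∑ a, u a • (a : Fin 1 → ℕ) = fun _ ↦ d * s := by
  have : d ∣ ∑ a, u a * (a : Fin 1 → ℕ) 0 :=
    Finset.dvd_sum fun a _ ↦ (hd a a.2).mul_left _
  obtain ⟨s, hs⟩ := this
  refine ⟨s, funext fun j ↦ ?_⟩
  rw [Subsingleton.elim j 0, ← hs]
  simp [Finset.sum_apply]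

/-- `T` divides `(T + 1)(s - s')` and is coprime to `T + 1`. The order hypothesis keeps `m` natural;
the other case follows by swapping sides. -/
theorem exists_eq_add_mul {T s s' t t' : ℕ} (hT : 0 < T)
    (h : (T + 1) * s + T * t = (T + 1) * s' + T * t') (hs : s' ≤ s) :
    ∃ m, s = s' + T * m ∧ t' = t + (T + 1) * m := by
  obtain ⟨δ, rfl⟩ := Nat.exists_eq_add_of_le hs
  have h1 : T * t' = T * t + (T + 1) * δ := by linarith
  have h2 : T ∣ (T + 1) * δ := (Nat.dvd_add_right (dvd_mul_right T t)).1 ⟨t', h1.symm⟩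
  obtain ⟨m, rfl⟩ := (Nat.coprime_self_add_right.2 (Nat.coprime_one_right T)).dvd_of_dvd_mul_left h2
  refine ⟨m, rfl, Nat.eq_of_mul_eq_mul_left hT ?_⟩
  rw [h1]
  ring

/-- Numerical semigroups can be glued, with disjoint multiples of the sets of generators. -/
theorem exists_isGluing_of_one (k : Type*) [Field k] (A B : Finset (Fin 1 → ℕ))
    (hA : ∃ a ∈ A, a ≠ 0) (hB : ∃ b ∈ B, b ≠ 0) :
    ∃ k₁ k₂ : ℕ, IsGluing k A B k₁ k₂ ∧
      (0 ∉ A ∨ 0 ∉ B → ∀ a ∈ A, ∀ b ∈ B, k₁ • a ≠ k₂ • b) := by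
  obtain ⟨d, hd, hdA, N, hN⟩ := exists_gcd A hA
  obtain ⟨e, he, heB, M, hM⟩ := exists_gcd B hB
  -- `N + M` puts `dT` in `⟨A⟩` and `e(T+1)` in `⟨B⟩`; the sum makes `T` exceed every generator of
  -- `A`, for disjointness; `+ 1` makes it positive.
  let T := N + M + ∑ a ∈ A, a 0 + 1
  have hT : 0 < T := Nat.succ_pos _
  obtain ⟨α, hα⟩ := hN T (by simp only [T]; omega)
  obtain ⟨β, hβ⟩ := hM (T + 1) (by simp only [T]; omega)
  refine ⟨e * (T + 1), d * T, isGluing_of_forall (by positivity) (by positivity) α β ?_ ?_, ?_⟩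
  · rw [hα, hβ]
    ext j
    simp
    ring
  · intro u u' v v' h
    have hαm : ∀ (u : A → ℕ) (m : ℕ), ∑ a, (u + m • α) a • (a : Fin 1 → ℕ) =
        ∑ a, u a • (a : Fin 1 → ℕ) + m • fun _ ↦ d * T := fun u m ↦ by
      simp only [Pi.add_apply, Pi.smul_apply, add_smul, Finset.sum_add_distrib, ← hα,
        Finset.smul_sum, smul_assoc]
    have hβm : ∀ (v : B → ℕ) (m : ℕ), ∑ b, (v + m • β) b • (b : Fin 1 → ℕ) =
        ∑ b, v b • (b : Fin 1 → ℕ) + m • fun _ ↦ e * (T + 1) := fun v m ↦ by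
      simp only [Pi.add_apply, Pi.smul_apply, add_smul, Finset.sum_add_distrib, ← hβ,
        Finset.smul_sum, smul_assoc]
    obtain ⟨s, hs⟩ := exists_eq_mul_of_dvd hdA u
    obtain ⟨s', hs'⟩ := exists_eq_mul_of_dvd hdA u'
    obtain ⟨t, ht⟩ := exists_eq_mul_of_dvd heB v
    obtain ⟨t', ht'⟩ := exists_eq_mul_of_dvd heB v'
    simp only [hαm, hβm, hs, hs', ht, ht'] at h ⊢
    have h0 := congrFun h 0
    simp only [Pi.add_apply, Pi.smul_apply, smul_eq_mul] at h0
    -- The common factor `d e` cancels, leaving the coprime coefficients `T + 1` and `T`.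
    have h1 : (T + 1) * s + T * t = (T + 1) * s' + T * t' := by
      refine Nat.eq_of_mul_eq_mul_left (Nat.mul_pos hd he) ?_
      linear_combination h0
    obtain hle | hle := le_total s' s
    · obtain ⟨m, rfl, rfl⟩ := exists_eq_add_mul hT h1 hle
      refine ⟨m, Or.inl ⟨?_, ?_⟩⟩ <;> ext j <;> simp <;> ring
    · obtain ⟨m, rfl, rfl⟩ := exists_eq_add_mul hT h1.symm hle
      refine ⟨m, Or.inr ⟨?_, ?_⟩⟩ <;> ext j <;> simp <;> ring
  · intro h0 a ha b hb hab
    have hab0 := congrFun hab 0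
    simp only [Pi.smul_apply, smul_eq_mul] at hab0
    obtain ⟨x, hx⟩ := hdA a ha
    obtain ⟨y, hy⟩ := heB b hb
    have hxy : (T + 1) * x = T * y := by
      refine Nat.eq_of_mul_eq_mul_left (Nat.mul_pos hd he) ?_
      rw [hx, hy] at hab0
      linear_combination hab0
    -- Since `x < T`, divisibility forces `x = 0`, so a coincidence can only occur at the zero
    -- vector.
    have hTx : T ∣ x :=
      (Nat.coprime_self_add_right.2 (Nat.coprime_one_right T)).dvd_of_dvd_mul_left ⟨y, hxy⟩
    have hlt : x < T := by
      have h1 : a 0 ≤ ∑ a ∈ A, a 0 :=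
        Finset.single_le_sum (f := fun a : Fin 1 → ℕ ↦ a 0) (fun _ _ ↦ Nat.zero_le _) ha
      have h2 : x ≤ a 0 := hx ▸ Nat.le_mul_of_pos_left x hd
      simp only [T]
      omega
    have hx0 : x = 0 := Nat.eq_zero_of_dvd_of_lt hTx hlt
    have hy0 : y = 0 := by
      rw [hx0, mul_zero] at hxy
      exact (Nat.mul_eq_zero.1 hxy.symm).resolve_left hT.ne'
    have ha0 : a = 0 := funext fun j ↦ by rw [Subsingleton.elim j 0, hx, hx0]; rfl
    have hb0 : b = 0 := funext fun j ↦ by rw [Subsingleton.elim j 0, hy, hy0]; rfl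
    subst ha0 hb0
    exact h0.elim (fun h ↦ h ha) fun h ↦ h hb

theorem Nondegenerate.exists_ne_zero {k : Type*} [Field k] {A : Finset (Fin 1 → ℕ)}
    (h : Nondegenerate k A) : ∃ a ∈ A, a ≠ 0 := by
  obtain ⟨s, hs, hn⟩ := h.exists_linearIndepOn
  obtain ⟨a, ha⟩ := (Set.ncard_pos (Set.toFinite s)).1 hn
  refine ⟨a, a.2, fun h0 ↦ hs.ne_zero ha ?_⟩
  rw [h0]
  rfl

end NumericalSemigroups

end SemigroupGluing

theorem theorem2p2 {k : Type*} [Field k] {n : ℕ} (hn : 1 ≤ n) (A B : Finset (Fin n → ℕ))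
    (hA : SemigroupGluing.IsCohenMacaulay (SemigroupGluing.SemigroupRing k A))
    (hB : SemigroupGluing.IsCohenMacaulay (SemigroupGluing.SemigroupRing k B)) :
    (SemigroupGluing.Nondegenerate k A → SemigroupGluing.Nondegenerate k B →
      (SemigroupGluing.CanBeGlued k A B ↔ n = 1) ∧
      (n = 1 → 0 ∉ A ∨ 0 ∉ B →
        ∃ k₁ k₂ : ℕ, SemigroupGluing.IsGluing k A B k₁ k₂ ∧
          ∀ a ∈ A, ∀ b ∈ B, k₁ • a ≠ k₂ • b)) ∧
    (2 ≤ n → SemigroupGluing.CanBeGlued k A B →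
      ¬ SemigroupGluing.Nondegenerate k A ∨ ¬ SemigroupGluing.Nondegenerate k B) := by
  refine ⟨fun h₁ h₂ ↦ ⟨⟨fun ⟨_, _, h⟩ ↦ le_antisymm (h.le_one h₁ h₂) hn, ?_⟩, ?_⟩, ?_⟩
  · rintro rfl
    obtain ⟨k₁, k₂, h, -⟩ := SemigroupGluing.exists_isGluing_of_one k A B h₁.exists_ne_zero
      h₂.exists_ne_zero
    exact ⟨k₁, k₂, h⟩
  · rintro rfl h0
    obtain ⟨k₁, k₂, h, hdisj⟩ := SemigroupGluing.exists_isGluing_of_one k A B h₁.exists_ne_zero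
      h₂.exists_ne_zero
    exact ⟨k₁, k₂, h, hdisj h0⟩
  · rintro h2 ⟨_, _, h⟩
    by_contra! hdeg
    exact absurd (h.le_one hdeg.1 hdeg.2) (by omega)
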